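/- \textbf{Setting.} Let $X$ be a proper geodesic metric space, $o\in X$ a base point, and $G$ a (discrete) group acting properly by isometries on $X$. Assume that $G$ is not virtually cyclic and contains a contracting element, i.e. some $g\in G$ such that, for a point $x\in X$, the map $\mathbb Z\to X$, $n\mapsto g^nx$ is a quasi-isometric embedding whose image $Y$ is contracting: $Y$ is closed and there is $\alpha>0$ such that every geodesic $\gamma$ with $d(\gamma,Y)\ge\alpha$ has a nearest-point projection on $Y$ of diameter at most $\alpha$. \emph{Boundary.} Let $\bar X$ be the closure of $\{b_z : z\in X\}$, $b_z(x,y)=d(x,z)-d(y,z)$, in the space of continuous cocycles $c\colon X\times X\to\mathbb R$ (that is, $c(x,z)=c(x,y)+c(y,z)$) with the topology of uniform convergence on compact sets; identify $z\in X$ with $b_z$, put $\partial X=\bar X\setminus X$, and let $\mathfrak B$ be the Borel $\sigma$-algebra. $G$ acts on $\bar X$ by $gc(x,y)=c(g^{-1}x,g^{-1}y)$. For $c,c'\in\bar X$ and $x\in X$ let $\langle c,c'\rangle_x=\frac12\sup_{z\in X}[c(x,z)+c'(x,z)]\in[0,\infty]$. The radial limit set is $$\Lambda_{\rm rad}(G)=\bigcup_{r\ge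 0} G\cdot\{c\in\partial X : \forall T\ge 0\ \exists g\in G,\ d(o,go)\ge T \text{ and } \langle o,c\rangle_{go}\le r\}.$$ \emph{Densities.} Let $\omega\ge 0$ and let $\nu=(\nu_x)_{x\in X}$ be a $G$-invariant $\omega$-conformal density supported on $\partial X$: the $\nu_x$ are finite, mutually absolutely continuous Borel measures on $\bar X$ with $\nu_x(\bar X\setminus\partial X)=0$, $\nu_o(\bar X)=1$, $g_*\nu_x=\nu_{gx}$ and $\frac{d\nu_x}{d\nu_y}(c)=e^{-\omega c(x,y)}$ for $\nu_y$-almost every $c$. \emph{Spaces.} Let $\partial^2X=\{(c,c')\in\partial X\times\partial X : \langle c,c'\rangle_o<\infty\}$ and $SX=\partial^2X\times\mathbb R$, with its Borel $\sigma$-algebra $\mathfrak L$, the geodesic flow $\phi_t(c,c',s)=(c,c',s+t)$ and the $G$-action $g(c,c',s)=(gc,gc',s+\frac12[c'(g^{-1}o,o)-c(g^{-1}o,o)])$. A gradient arc for $c\in\bar X$ is a path $\eta\colon I\to X$ on an interval, parametrized by arc length, with $c(\eta(s),\eta(t))=t-s$ for all $s,t\in I$; it ends at $c$ if $c\in X$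 and $c$ is the terminal point of $\eta$, or $c\in\partial X$ and $I$ is unbounded above. A complete gradient arc from $c$ to $c'$ is a gradient arc for $c'$ ending at $c'$ whose reverse is a gradient arc for $c$ ending at $c$. A set $U\subset\bar X\times\bar X$ is squeezing if there is a compact $K\subset X$ that meets every complete gradient arc from $c$ to $c'$, for all $(c,c')\in U$. Let $\partial_0^2X$ be the set of pairs in $\partial X\times\partial X$ that have a squeezing neighbourhood in $\bar X\times\bar X$, and let $S_0X\subset SX$ be the set of all $(c,c',s)$ with $(c,c')\in\partial^2_0X$. \emph{Measures.} Let $m=\mu\otimes ds$ on $(SX,\mathfrak L)$, where $\mu=e^{2\omega\langle c,c'\rangle_o}\,\nu_o\otimes\nu_o$ on $\partial^2X$. Let $\mathfrak L_G$ be the $\sigma$-algebra of $G$-invariant sets in $\mathfrak L$. For a measurable fundamental domain $D$ of $S_0X$ (a set $D\in\mathfrak L$, $D\subset S_0X$, that meets every $G$-orbit in $S_0X$ in exactly one point), let $m_G$ be the restriction to $\mathfrak L_G$ of $\xi\mathbf 1_D\,m$, where $\xi(v)=1/|G_v|$ and $G_v$ is the stabilizer of $v$ in $G$ (with $1/\infty=0$).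 \emph{Dissipativity.} Let $H$ be a discrete countable group with the counting measure, or $\mathbb R$ with the Lebesgue measure, acting measurably on a measure space $(\Omega,\mathfrak A,\lambda)$. A set $W\in\mathfrak A$ is wandering if $\int_H\mathbf 1_W(hx)\,dh<\infty$ for $\lambda$-almost every $x\in W$. The action is dissipative if $\Omega$ is, up to measure zero, a countable union of wandering sets. \textbf{Proposition.} Assume that $\nu_o(\Lambda_{\rm rad}(G))=0$. Then \begin{enumerate} \item the diagonal action of $G$ on $(\partial_0^2X,\mathfrak B\otimes\mathfrak B,\nu_o\otimes\nu_o)$ is dissipative; \item a measurable fundamental domain $D$ of $S_0X$ exists and, for every such $D$, the geodesic flow on $(SX,\mathfrak L_G,m_G)$ is dissipative. \end{enumerate} -/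

import Mathlib

open MeasureTheory Set Topology
open scoped ENNReal

noncomputable section

namespace Horo

/-! ### Geodesics, contracting elements -/

section Geometry

variable (X : Type*) [MetricSpace X]

/-- Any two points of `X` are joined by a geodesic segment. -/
def IsGeodesicSpace : Prop :=
  ∀ x y : X, ∃ γ : ℝ → X, γ 0 = x ∧ γ (dist x y) = y ∧
    ∀ s ∈ Icc 0 (dist x y), ∀ t ∈ Icc 0 (dist x y), dist (γ s) (γ t) = |s - t|

variable {X}

/-- `γ` restricted to the interval `I` is a geodesic (an isometric embedding of `I`). -/
def IsGeodesicOn (γ : ℝ → X) (I : Set ℝ) : Prop :=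
  I.OrdConnected ∧ ∀ s ∈ I, ∀ t ∈ I, dist (γ s) (γ t) = |s - t|

/-- The nearest-point projection of the set `Z` onto `Y`: all `y ∈ Y` with `d(z, y) = d(z, Y)` for
some `z ∈ Z`. -/
def setProj (Y Z : Set X) : Set X :=
  {y | y ∈ Y ∧ ∃ z ∈ Z, ∀ y' ∈ Y, dist z y ≤ dist z y'}

/-- `Y` is closed, and every geodesic at distance at least `α` from `Y` has a projection onto `Y` of
diameter at most `α`. -/
def IsContractingSetWith (α : ℝ) (Y : Set X) : Prop :=
  IsClosed Y ∧ ∀ (γ : ℝ → X) (I : Set ℝ), IsGeodesicOn γ I →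
    (∀ s ∈ I, ∀ y ∈ Y, α ≤ dist (γ s) y) →
    ∀ p ∈ setProj Y (γ '' I), ∀ q ∈ setProj Y (γ '' I), dist p q ≤ α

def IsContractingSet (Y : Set X) : Prop := ∃ α : ℝ, 0 < α ∧ IsContractingSetWith α Y

/-- The orbit map `n ↦ gⁿ x` is a quasi-isometric embedding of `ℤ` with contracting image. -/
def IsContractingElement {G : Type*} [Group G] [MulAction G X] (g : G) : Prop :=
  ∃ x : X, (∃ k l : ℝ, 1 ≤ k ∧ 0 ≤ l ∧ ∀ m n : ℤ,
      k⁻¹ * |(m : ℝ) - n| - l ≤ dist (g ^ m • x) (g ^ n • x) ∧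
      dist (g ^ m • x) (g ^ n • x) ≤ k * |(m : ℝ) - n| + l) ∧
    IsContractingSet (range fun n : ℤ => g ^ n • x)

/-- The group has a cyclic subgroup of finite index. -/
def IsVirtuallyCyclic (G : Type*) [Group G] : Prop :=
  ∃ H : Subgroup G, H.FiniteIndex ∧ IsCyclic H

end Geometry

/-! ### Horocompactification -/

section Horocompactification

variable (X : Type*) [MetricSpace X]

/-- Continuous cocycles `X × X → ℝ`, with the topology of uniform convergence on compact sets. -/
abbrev Cocycle : Type _ :=
  {c : C(X × X, ℝ) // ∀ x y z : X, c (x, z) = c (x, y) + c (y, z)}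

variable {X}

/-- The cocycle `b_z(x, y) = d(x, z) - d(y, z)`. -/
def pointCocycle (z : X) : Cocycle X :=
  ⟨⟨fun p => dist p.1 z - dist p.2 z, by fun_prop⟩, fun x y w => by simp⟩

variable (X) in
/-- The horocompactification: the closure of the set of all `b_z` in the space of cocycles. -/
def Compactification : Type _ := closure (range (pointCocycle (X := X)))

instance : TopologicalSpace (Compactification X) :=
  inferInstanceAs (TopologicalSpace (closure (range (pointCocycle (X := X)))))

/-- The Borel σ-algebra `𝔅`. -/
instance : MeasurableSpace (Compactification X) := borel _

instance : BorelSpace (Compactification X) := ⟨rfl⟩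

/-- The value `c(x, y)` of a point of the compactification, seen as a cocycle. -/
def Compactification.eval (c : Compactification X) (x y : X) : ℝ := c.1.1 (x, y)

instance : CoeFun (Compactification X) fun _ => X → X → ℝ := ⟨Compactification.eval⟩

theorem Compactification.ext {b c : Compactification X} (h : ∀ x y, b x y = c x y) : b = c :=
  Subtype.ext (Subtype.ext (ContinuousMap.ext fun p => h p.1 p.2))

/-- The embedding of `X` in its horocompactification. -/
def toCompactification (z : X) : Compactification X :=
  ⟨pointCocycle z, subset_closure (mem_range_self z)⟩

variable (X) in
/-- The horoboundary `∂X`. -/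
def horoboundary : Set (Compactification X) := (range toCompactification)ᶜ

theorem Compactification.le_dist (c : Compactification X) (x y : X) : c x y ≤ dist x y := by
  have hcl : IsClosed {b : Cocycle X | b.1 (x, y) ≤ dist x y} :=
    isClosed_le (by fun_prop) continuous_const
  have hsub : range (pointCocycle (X := X)) ⊆ {b : Cocycle X | b.1 (x, y) ≤ dist x y} := by
    rintro _ ⟨z, rfl⟩
    have := dist_triangle x y z
    simp only [pointCocycle, mem_ofPred_eq, ContinuousMap.coe_mk]
    linarith
  exact closure_minimal hsub hcl c.2

theorem Compactification.cocycle (c : Compactification X) (x y z : X) :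
    c x z = c x y + c y z := c.1.2 x y z

/-- The Gromov product `½ sup_z [c(x, z) + c'(x, z)]`, with values in `[0, ∞]`. Truncating the
negative values of the bracket is harmless, as it vanishes at `z = x`. -/
def gromovProduct (c c' : Compactification X) (x : X) : ℝ≥0∞ :=
  ⨆ z : X, ENNReal.ofReal ((c x z + c' x z) / 2)

theorem gromovProduct_le (c c' : Compactification X) (x y : X) :
    gromovProduct c c' x ≤ ENNReal.ofReal (dist x y) + gromovProduct c c' y := by
  refine iSup_le fun z => ?_
  have h1 := c.cocycle x y z
  have h2 := c'.cocycle x y z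
  have h3 := c.le_dist x y
  have h4 := c'.le_dist x y
  calc ENNReal.ofReal ((c x z + c' x z) / 2)
      ≤ ENNReal.ofReal (dist x y + (c y z + c' y z) / 2) :=
        ENNReal.ofReal_le_ofReal (by linarith)
    _ ≤ ENNReal.ofReal (dist x y) + ENNReal.ofReal ((c y z + c' y z) / 2) :=
        ENNReal.ofReal_add_le
    _ ≤ _ := add_le_add le_rfl
        (le_iSup (fun z => ENNReal.ofReal ((c y z + c' y z) / 2)) z)

/-- The shadow `𝒪_x(y, r)`. -/
def shadow (x y : X) (r : ℝ) : Set (Compactification X) :=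
  {c | gromovProduct (toCompactification x) c y ≤ ENNReal.ofReal r}

/-- `ν` restricted to the interval `I` is parametrized by arc length and is a gradient arc
for `c`. -/
def IsGradientArc (c : Compactification X) (I : Set ℝ) (ν : ℝ → X) : Prop :=
  I.OrdConnected ∧ HasUnitSpeedOn ν I ∧ ∀ s ∈ I, ∀ t ∈ I, c (ν s) (ν t) = t - s

/-- The path `ν` with domain `I` ends at `c`. -/
def EndsAt (c : Compactification X) (I : Set ℝ) (ν : ℝ → X) : Prop :=
  (∃ z : X, c = toCompactification z ∧ ∃ b : ℝ, IsGreatest I b ∧ ν b = z) ∨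
    (c ∈ horoboundary X ∧ ¬ BddAbove I)

/-- `ν` with domain `I` is a complete gradient arc from `c` to `c'`. -/
def IsCompleteGradientArc (c c' : Compactification X) (I : Set ℝ) (ν : ℝ → X) : Prop :=
  (IsGradientArc c' I ν ∧ EndsAt c' I ν) ∧
    IsGradientArc c (Neg.neg ⁻¹' I) (fun t => ν (-t)) ∧ EndsAt c (Neg.neg ⁻¹' I) (fun t => ν (-t))

/-- There is a compact set (a bottleneck) which every complete gradient arc from `c` to `c'`
meets, for all `(c, c') ∈ U`. -/
def IsSqueezing (U : Set (Compactification X × Compactification X)) : Prop :=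
  ∃ K : Set X, IsCompact K ∧ ∀ p ∈ U, ∀ (I : Set ℝ) (ν : ℝ → X),
    IsCompleteGradientArc p.1 p.2 I ν → ∃ t ∈ I, ν t ∈ K

/-- The double boundary `∂²X` (it does not depend on the base point `o`). -/
def doubleBoundary (o : X) : Set (Compactification X × Compactification X) :=
  {p | p.1 ∈ horoboundary X ∧ p.2 ∈ horoboundary X ∧ gromovProduct p.1 p.2 o < ∞}

variable (X) in
/-- The set `∂₀²X` of pairs in `∂X × ∂X` with a squeezing neighbourhood in the square of the
compactification. -/
def squeezingBoundary : Set (Compactification X × Compactification X) :=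
  {p | p.1 ∈ horoboundary X ∧ p.2 ∈ horoboundary X ∧ ∃ U ∈ 𝓝 p, IsSqueezing U}

/-- The space `SX = ∂²X × ℝ` of the abstract geodesic flow. -/
def SX (o : X) : Type _ := doubleBoundary o × ℝ

/-- The σ-algebra `𝔏`, product of `𝔅 ⊗ 𝔅` on `∂²X` and the Borel σ-algebra of `ℝ`. -/
instance (o : X) : MeasurableSpace (SX o) :=
  inferInstanceAs (MeasurableSpace (doubleBoundary o × ℝ))

/-- The geodesic flow `φ_t (c, c', s) = (c, c', s + t)`. -/
def geodesicFlow (o : X) (t : ℝ) (v : SX o) : SX o := (v.1, v.2 + t)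

/-- The subspace `S₀X` of all vectors `(c, c', s)` with `(c, c') ∈ ∂₀²X`. -/
def S₀X (o : X) : Set (SX o) :=
  {v | (v.1 : Compactification X × Compactification X) ∈ squeezingBoundary X}

end Horocompactification

/-! ### The actions of the group -/

section Action

variable {X : Type*} [MetricSpace X] {G : Type*} [Group G] [MulAction G X] [IsIsometricSMul G X]

/-- `(gc)(x, y) = c(g⁻¹x, g⁻¹y)` on continuous cocycles. -/
def cocycleSMul (g : G) (c : Cocycle X) : Cocycle X :=
  ⟨c.1.comp ⟨fun p => (g⁻¹ • p.1, g⁻¹ • p.2), by fun_prop⟩, fun x y z => c.2 _ _ _⟩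

theorem continuous_cocycleSMul (g : G) : Continuous (cocycleSMul (X := X) g) :=
  ((ContinuousMap.continuous_precomp _).comp continuous_subtype_val).subtype_mk _

theorem cocycleSMul_pointCocycle (g : G) (z : X) :
    cocycleSMul g (pointCocycle z) = pointCocycle (g • z) := by
  refine Subtype.ext (ContinuousMap.ext fun p => ?_)
  change dist (g⁻¹ • p.1) z - dist (g⁻¹ • p.2) z = dist p.1 (g • z) - dist p.2 (g • z)
  rw [← dist_smul g (g⁻¹ • p.1) z, ← dist_smul g (g⁻¹ • p.2) z, smul_inv_smul, smul_inv_smul]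

theorem cocycleSMul_mem (g : G) {c : Cocycle X} (hc : c ∈ closure (range (pointCocycle (X := X)))) :
    cocycleSMul g c ∈ closure (range (pointCocycle (X := X))) := by
  refine map_mem_closure (continuous_cocycleSMul g) hc ?_
  rintro _ ⟨z, rfl⟩
  exact ⟨g • z, (cocycleSMul_pointCocycle g z).symm⟩

instance : SMul G (Compactification X) := ⟨fun g c => ⟨cocycleSMul g c.1, cocycleSMul_mem g c.2⟩⟩

theorem smul_eval (g : G) (c : Compactification X) (x y : X) :
    (g • c) x y = c (g⁻¹ • x) (g⁻¹ • y) := rfl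

instance : MulAction G (Compactification X) where
  one_smul c := Compactification.ext fun x y => by simp [smul_eval]
  mul_smul g h c := Compactification.ext fun x y => by simp [smul_eval, mul_smul]

theorem smul_toCompactification (g : G) (z : X) :
    g • toCompactification z = toCompactification (g • z) :=
  Subtype.ext (cocycleSMul_pointCocycle g z)

instance : ContinuousConstSMul G (Compactification X) :=
  ⟨fun g => ((continuous_cocycleSMul g).comp continuous_subtype_val).subtype_mk _⟩

theorem smul_mem_horoboundary (g : G) {c : Compactification X} (hc : c ∈ horoboundary X) :
    g • c ∈ horoboundary X := by
  rintro ⟨z, hz⟩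
  exact hc ⟨g⁻¹ • z, by rw [← smul_toCompactification, hz, inv_smul_smul]⟩

theorem gromovProduct_smul (g : G) (c c' : Compactification X) (x : X) :
    gromovProduct (g • c) (g • c') (g • x) = gromovProduct c c' x := by
  unfold gromovProduct
  rw [← (MulAction.toPerm g : Equiv.Perm X).iSup_comp]
  simp [smul_eval]

theorem smul_mem_doubleBoundary (o : X) (g : G) {p : Compactification X × Compactification X}
    (hp : p ∈ doubleBoundary o) : g • p ∈ doubleBoundary o := by
  refine ⟨smul_mem_horoboundary g hp.1, smul_mem_horoboundary g hp.2.1, ?_⟩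
  refine (gromovProduct_le _ _ o (g • o)).trans_lt (ENNReal.add_lt_top.2 ⟨ENNReal.ofReal_lt_top, ?_⟩)
  exact (gromovProduct_smul g p.1 p.2 o).trans_lt hp.2.2

theorem IsGradientArc.smul (g : G) {c : Compactification X} {I : Set ℝ} {ν : ℝ → X}
    (h : IsGradientArc c I ν) : IsGradientArc (g • c) I (fun t => g • ν t) := by
  refine ⟨h.1, ?_, fun s hs t ht => by simpa [smul_eval] using h.2.2 s hs t ht⟩
  intro x hx y hy
  rw [← h.2.1 hx hy]
  simp [eVariationOn]

theorem EndsAt.smul (g : G) {c : Compactification X} {I : Set ℝ} {ν : ℝ → X}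
    (h : EndsAt c I ν) : EndsAt (g • c) I (fun t => g • ν t) := by
  rcases h with ⟨z, rfl, b, hb, rfl⟩ | ⟨h1, h2⟩
  · exact .inl ⟨_, smul_toCompactification g _, b, hb, rfl⟩
  · exact .inr ⟨smul_mem_horoboundary g h1, h2⟩

theorem IsCompleteGradientArc.smul (g : G) {c c' : Compactification X} {I : Set ℝ} {ν : ℝ → X}
    (h : IsCompleteGradientArc c c' I ν) :
    IsCompleteGradientArc (g • c) (g • c') I (fun t => g • ν t) :=
  ⟨⟨h.1.1.smul g, h.1.2.smul g⟩, h.2.1.smul g, h.2.2.smul g⟩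

theorem smul_mem_squeezingBoundary (g : G) {p : Compactification X × Compactification X}
    (hp : p ∈ squeezingBoundary X) : g • p ∈ squeezingBoundary X := by
  obtain ⟨h1, h2, U, hU, K, hK, hKU⟩ := hp
  refine ⟨smul_mem_horoboundary g h1, smul_mem_horoboundary g h2,
    (fun q => g⁻¹ • q) ⁻¹' U, ?_, (fun x => g • x) '' K, hK.image (by fun_prop), ?_⟩
  · refine (continuous_const_smul g⁻¹).continuousAt.preimage_mem_nhds ?_
    rwa [inv_smul_smul]
  · intro q hq I ν hν
    obtain ⟨t, ht, hK⟩ := hKU _ hq I _ (hν.smul g⁻¹)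
    exact ⟨t, ht, _, hK, smul_inv_smul g _⟩

instance (o : X) : MulAction G (doubleBoundary o) where
  smul g p := ⟨g • p.1, smul_mem_doubleBoundary o g p.2⟩
  one_smul p := Subtype.ext (one_smul G p.1)
  mul_smul g h p := Subtype.ext (mul_smul g h p.1)

/-- The diagonal action of `G` on `∂₀²X`. -/
instance : MulAction G (squeezingBoundary X) where
  smul g p := ⟨g • p.1, smul_mem_squeezingBoundary g p.2⟩
  one_smul p := Subtype.ext (one_smul G p.1)
  mul_smul g h p := Subtype.ext (mul_smul g h p.1)

/-- The translation `τ(g, v) = ½ [c'(g⁻¹o, o) - c(g⁻¹o, o)]`, where `v = (c, c', s)`. -/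
def translation (o : X) (g : G) (v : SX o) : ℝ :=
  (v.1.1.2 (g⁻¹ • o) o - v.1.1.1 (g⁻¹ • o) o) / 2

/-- The action `g (c, c', s) = (gc, gc', s + τ(g, v))` on `SX`. -/
instance (o : X) : MulAction G (SX o) where
  smul g v := (g • v.1, v.2 + translation o g v)
  one_smul v := by
    refine Prod.ext (one_smul G v.1) ?_
    change v.2 + translation o (1 : G) v = v.2
    have h1 := v.1.1.1.cocycle o o o
    have h2 := v.1.1.2.cocycle o o o
    simp only [translation, inv_one, one_smul]
    linarith
  mul_smul g h v := by
    refine Prod.ext (mul_smul g h v.1) ?_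
    change v.2 + translation o (g * h) v =
      v.2 + translation o h v + translation o g (h • v.1, v.2 + translation o h v)
    have h1 := v.1.1.1.cocycle (h⁻¹ • g⁻¹ • o) (h⁻¹ • o) o
    have h2 := v.1.1.2.cocycle (h⁻¹ • g⁻¹ • o) (h⁻¹ • o) o
    change _ = v.2 + translation o h v +
      (v.1.1.2 (h⁻¹ • g⁻¹ • o) (h⁻¹ • o) - v.1.1.1 (h⁻¹ • g⁻¹ • o) (h⁻¹ • o)) / 2
    simp only [translation, mul_inv_rev, mul_smul]
    linarith

variable (G)

/-- The radial limit set `Λ_rad(G)`: the union over `r ≥ 0` of the `G`-translates of the set of all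
`c ∈ ∂X` that lie in shadows `𝒪_o(go, r)` with `d(o, go)` arbitrarily large. -/
def radialLimitSet (o : X) : Set (Compactification X) :=
  ⋃ (r : ℝ) (_ : 0 ≤ r) (h : G), (fun c => h • c) ''
    {c | c ∈ horoboundary X ∧ ∀ T : ℝ, 0 ≤ T → ∃ g : G, T ≤ dist o (g • o) ∧ c ∈ shadow o (g • o) r}

/-- The σ-algebra `𝔏_G` of all `G`-invariant sets in `𝔏`. -/
@[reducible]
def invariantSigma (o : X) : MeasurableSpace (SX o) where
  MeasurableSet' B := MeasurableSet B ∧ ∀ g : G, (fun v => g • v) ⁻¹' B = B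
  measurableSet_empty := ⟨MeasurableSet.empty, fun _ => rfl⟩
  measurableSet_compl B hB := ⟨hB.1.compl, fun g => by rw [preimage_compl, hB.2 g]⟩
  measurableSet_iUnion B hB := ⟨MeasurableSet.iUnion fun n => (hB n).1, fun g => by
    rw [preimage_iUnion]; exact iUnion_congr fun n => (hB n).2 g⟩

theorem invariantSigma_le (o : X) :
    invariantSigma G o ≤ (inferInstance : MeasurableSpace (SX o)) := fun _ hB => hB.1

/-- `D ⊆ S₀X` belongs to `𝔏` and meets every `G`-orbit of `S₀X` in exactly one point. -/
def IsMeasurableDomain (o : X) (D : Set (SX o)) : Prop :=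
  MeasurableSet D ∧ D ⊆ S₀X o ∧ ∀ v ∈ S₀X o, ∃! w, w ∈ D ∧ w ∈ MulAction.orbit G v

/-- `ξ(v) = 1 / |G_v|`, which is `0` if the stabilizer of `v` is infinite. -/
def stabWeight (o : X) (v : SX o) : ℝ≥0∞ := ((ENat.card (MulAction.stabilizer G v) : ℕ∞) : ℝ≥0∞)⁻¹

/-- `ν` is a density, normalized at `o`. -/
structure IsDensity (o : X) (ν : X → Measure (Compactification X)) : Prop where
  finite : ∀ x, IsFiniteMeasure (ν x)
  absolutelyContinuous : ∀ x y, ν x ≪ ν y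
  normalized : ν o univ = 1

/-- `g_* ν_x = ν_{gx}`. -/
def IsInvariantDensity (ν : X → Measure (Compactification X)) : Prop :=
  ∀ (g : G) (x : X), (ν x).map (fun c => g • c) = ν (g • x)

variable {G}

/-- `dν_x / dν_y (c) = e^{-ω c(x, y)}` for `ν_y`-almost every `c`. -/
def IsConformalDensity (ω : ℝ) (ν : X → Measure (Compactification X)) : Prop :=
  ∀ x y : X, (ν x).rnDeriv (ν y) =ᵐ[ν y] fun c => ENNReal.ofReal (Real.exp (-ω * c x y))

/-- The Bowen–Margulis current `μ = D_o^{-2ω} ν_o ⊗ ν_o` on `∂²X`, where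
`D_o(c, c') = e^{-(c | c')_o}`. -/
def bmCurrent (o : X) (ω : ℝ) (ν : X → Measure (Compactification X)) :
    Measure (doubleBoundary o) :=
  (((ν o).prod (ν o)).comap Subtype.val).withDensity fun p =>
    ENNReal.ofReal (Real.exp (2 * ω * (gromovProduct p.1.1 p.1.2 o).toReal))

/-- The Bowen–Margulis measure `m = μ ⊗ ds` on `(SX, 𝔏)`. -/
def bmMeasure (o : X) (ω : ℝ) (ν : X → Measure (Compactification X)) : Measure (SX o) :=
  (bmCurrent o ω ν).prod (volume : Measure ℝ)

variable (G)

/-- The measure `m_G = ξ 1_D m` on `(SX, 𝔏_G)`, for a measurable fundamental domain `D`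
of `S₀X`. -/
def bmQuotientMeasure (o : X) (ω : ℝ) (ν : X → Measure (Compactification X)) (D : Set (SX o)) :
    @Measure (SX o) (invariantSigma G o) :=
  ((bmMeasure o ω ν).withDensity (D.indicator (stabWeight G o))).trim (invariantSigma_le G o)

end Action

/-! ### Dissipative actions -/

section Dissipative

/-- `W` is wandering for the action `act` of `H`, endowed with the Haar measure `dh`:
`∫_H 1_W(h ω) dh < ∞` for `μ`-almost every `ω ∈ W`. -/
def IsWandering {H Ω : Type*} [MeasurableSpace H] [MeasurableSpace Ω] (act : H → Ω → Ω)
    (dh : Measure H) (μ : Measure Ω) (W : Set Ω) : Prop :=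
  ∀ᵐ x ∂μ, x ∈ W → ∫⁻ h, W.indicator 1 (act h x) ∂dh < ∞

/-- Up to measure zero, `Ω` is a countable union of measurable wandering sets. -/
def IsDissipative {H Ω : Type*} [MeasurableSpace H] [MeasurableSpace Ω] (act : H → Ω → Ω)
    (dh : Measure H) (μ : Measure Ω) : Prop :=
  ∃ W : ℕ → Set Ω, (∀ n, MeasurableSet (W n) ∧ IsWandering act dh μ (W n)) ∧
    μ (⋃ n, W n)ᶜ = 0

/-- The action of the discrete group `G`, endowed with the counting measure, is dissipative. -/
def IsDissipativeSMul (G : Type*) {Ω : Type*} [Group G] [MulAction G Ω] [MeasurableSpace Ω]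
    (μ : Measure Ω) : Prop :=
  letI : MeasurableSpace G := ⊤
  IsDissipative (fun (g : G) (x : Ω) => g • x) Measure.count μ

/-- The flow `φ` of `ℝ`, endowed with the Lebesgue measure, on the measure space `(Ω, 𝔄, μ)` is
dissipative. -/
def IsDissipativeFlow {Ω : Type*} (𝔄 : MeasurableSpace Ω) (φ : ℝ → Ω → Ω) (μ : @Measure Ω 𝔄) :
    Prop :=
  IsDissipative φ volume μ

end Dissipative

end Horo

end

namespace Horo

/-! ### Density of `X` in its compactification, and geodesic segments as gradient arcs. -/

section Geometry

variable {X : Type*} [MetricSpace X]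

/-! Let `U` be an open squeezing set with both `p = (c, c')` and `gp` in `U`. Geodesics joining
pairs of points of `X` near `p` pass close to `o` and to `g⁻¹o`. In the limit this gives, up to a
bounded error, `c'(o, g⁻¹o) ≈ d(o, g⁻¹o) ≈ -c(o, g⁻¹o)`, or the same with `c` and `c'` exchanged
(`IsSqueezing.exists_isCoarselyOrdered`). Everything follows from this estimate.

If infinitely many `g` bring `p` back to `U`, then `c` or `c'` lies in infinitely many shadows
`𝒪_o(g⁻¹o, r)`, so it is a radial limit point. When `Λ_rad(G)` is null, almost every pair therefore
visits `U` finitely often (`IsSqueezing.finite_smul_mem`). As countably many such `U` cover `∂₀²X`,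
this is the first claim.

The translation `τ(g, v)` also has absolute value about `d(o, g⁻¹o)`, so every vector visits a flow
box `U × (-T, T)` finitely often (`IsSqueezing.finite_smul_mem_SX`), and choosing a canonical visit
in each orbit gives `D`. A flow line whose ends are not radial meets only finitely many translates
of a box, each for a time at most `2T`. Hence the saturations of the boxes are wandering for the
flow (`sojournTime_lt_top`). -/

theorem denseRange_toCompactification : DenseRange (toCompactification (X := X)) := by
  refine Subtype.dense_iff.2 (closure_mono ?_)
  rintro _ ⟨z, rfl⟩
  exact ⟨toCompactification z, mem_range_self z, rfl⟩

theorem Compactification.continuous_eval (x y : X) :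
    Continuous fun c : Compactification X => c x y :=
  (continuous_eval_const (F := C(X × X, ℝ)) (x, y)).comp
    (continuous_subtype_val.comp continuous_subtype_val)

/-- The variation sums of an isometric path agree term by term with those of the identity of `ℝ`. -/
theorem hasUnitSpeedOn_of_isometric {γ : ℝ → X} {I : Set ℝ}
    (h : ∀ s ∈ I, ∀ t ∈ I, dist (γ s) (γ t) = |s - t|) : HasUnitSpeedOn γ I := by
  intro x hx y hy
  have hid := (monotone_id (α := ℝ)).monotoneOn I |>.eVariationOn_eq hx hy
  simp only [NNReal.coe_one, one_mul]
  rw [id, id] at hid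
  rw [← hid]
  unfold eVariationOn
  refine iSup_congr fun p => Finset.sum_congr rfl fun i _ => ?_
  rw [edist_dist, edist_dist, h _ (p.2.2.2 _).1 _ (p.2.2.2 _).1, Real.dist_eq, id, id]

theorem isGradientArc_toCompactification {γ : ℝ → X} {I : Set ℝ} {z : X} {b : ℝ}
    (hI : I.OrdConnected) (h : ∀ s ∈ I, ∀ t ∈ I, dist (γ s) (γ t) = |s - t|)
    (hz : ∀ s ∈ I, dist (γ s) z = b - s) : IsGradientArc (toCompactification z) I γ := by
  refine ⟨hI, hasUnitSpeedOn_of_isometric h, fun s hs t ht => ?_⟩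
  change dist (γ s) z - dist (γ t) z = t - s
  rw [hz s hs, hz t ht]
  ring

/-- A geodesic segment is a complete gradient arc between its endpoints. -/
theorem isCompleteGradientArc_of_isometric {γ : ℝ → X} {L : ℝ} (hL : 0 ≤ L)
    (h : ∀ s ∈ Icc 0 L, ∀ t ∈ Icc 0 L, dist (γ s) (γ t) = |s - t|) :
    IsCompleteGradientArc (toCompactification (γ 0)) (toCompactification (γ L)) (Icc 0 L) γ := by
  have h0 : (0 : ℝ) ∈ Icc 0 L := ⟨le_rfl, hL⟩
  have h1 : L ∈ Icc 0 L := ⟨hL, le_rfl⟩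
  have hneg : Neg.neg ⁻¹' Icc 0 L = Icc (-L) 0 := by
    ext t
    simp only [mem_preimage, mem_Icc]
    constructor <;> rintro ⟨_, _⟩ <;> constructor <;> linarith
  refine ⟨⟨isGradientArc_toCompactification (b := L) ordConnected_Icc h fun s hs => ?_,
    .inl ⟨_, rfl, L, ⟨h1, fun t ht => ht.2⟩, rfl⟩⟩,
    isGradientArc_toCompactification (b := 0) (hneg ▸ ordConnected_Icc) (fun s hs t ht => ?_)
      fun s hs => ?_,
    .inl ⟨_, rfl, 0, ⟨by simpa using hL, fun t ht => ?_⟩, by simp⟩⟩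
  · rw [h s hs L h1, abs_of_nonpos (by linarith [hs.2])]
    ring
  · rw [h _ hs _ ht, ← abs_neg]
    congr 1
    ring
  · rw [h _ hs _ h0, abs_of_nonneg (by linarith [hs.1])]
    ring
  · have := ht.1
    linarith

end Geometry

/-! ### Finiteness and countability from the proper action. -/

section ProperAction

variable {X : Type*} [MetricSpace X] [ProperSpace X] (G : Type*) [Group G] [MulAction G X]
  [ProperlyDiscontinuousSMul G X]

theorem finite_dist_smul_le (o : X) (T : ℝ) : {g : G | dist o (g • o) ≤ T}.Finite := by
  refine (ProperlyDiscontinuousSMul.finite_disjoint_inter_image (Γ := G) (isCompact_singleton (x := o))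
    (isCompact_closedBall o T)).subset fun g hg => ⟨g • o, ⟨o, rfl, rfl⟩, ?_⟩
  rw [Metric.mem_closedBall, dist_comm]
  exact hg

theorem countable_of_properlyDiscontinuous (o : X) : Countable G := by
  rw [← countable_univ_iff]
  refine (countable_iUnion fun n : ℕ => (finite_dist_smul_le G o n).countable).mono fun g _ => ?_
  obtain ⟨n, hn⟩ := exists_nat_ge (dist o (g • o))
  exact mem_iUnion.2 ⟨n, hn⟩

end ProperAction

/-! ### Returns to squeezing sets and radial limit points. -/

section Action

variable {X : Type*} [MetricSpace X] {G : Type*} [Group G] [MulAction G X] [IsIsometricSMul G X]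

/-- Along `(c, c')` the points `x` and `y` are ordered from `c` to `c'`, up to an error `C`. -/
def IsCoarselyOrdered (C : ℝ) (c c' : Compactification X) (x y : X) : Prop :=
  dist x y - C ≤ c' x y ∧ c x y ≤ C - dist x y

/-- A geodesic from `x` to `y` and its `g`-translate both meet `K`, so the geodesic itself passes
within `R` of `o` at time `s` and of `g⁻¹o` at time `t`. The order of `s` and `t` decides the
alternative. Replacing the two points on the geodesic by `o` and `g⁻¹o` costs `2R` in the cocycle
and `2R` in the distance, whence `4 * R`. -/
theorem isCoarselyOrdered_of_squeezing (hX : IsGeodesicSpace X) {o : X} {R : ℝ}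
    {U : Set (Compactification X × Compactification X)} {K : Set X}
    (hK : K ⊆ Metric.closedBall o R)
    (hKU : ∀ p ∈ U, ∀ (I : Set ℝ) (γ : ℝ → X),
      IsCompleteGradientArc p.1 p.2 I γ → ∃ t ∈ I, γ t ∈ K)
    {x y : X} {g : G} (hp : (toCompactification x, toCompactification y) ∈ U)
    (hgp : g • (toCompactification x, toCompactification y) ∈ U) :
    IsCoarselyOrdered (4 * R) (toCompactification x) (toCompactification y) o (g⁻¹ • o) ∨
      IsCoarselyOrdered (4 * R) (toCompactification y) (toCompactification x) o (g⁻¹ • o) := by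
  obtain ⟨γ, h0, h1, hγ⟩ := hX x y
  have harc := isCompleteGradientArc_of_isometric dist_nonneg hγ
  rw [h0, h1] at harc
  obtain ⟨s, hs, hsK⟩ := hKU _ hp _ _ harc
  obtain ⟨t, ht, htK⟩ := hKU _ hgp _ _ (harc.smul g)
  have hso : dist (γ s) o ≤ R := hK hsK
  have hto : dist (γ t) (g⁻¹ • o) ≤ R := by
    rw [← dist_smul g, smul_inv_smul]
    exact hK htK
  have h0m : (0 : ℝ) ∈ Icc 0 (dist x y) := ⟨le_rfl, dist_nonneg⟩
  have h1m : dist x y ∈ Icc 0 (dist x y) := ⟨dist_nonneg, le_rfl⟩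
  have dx : ∀ u ∈ Icc 0 (dist x y), dist (γ u) x = u := fun u hu => by
    have := hγ u hu 0 h0m
    rwa [h0, sub_zero, abs_of_nonneg hu.1] at this
  have dy : ∀ u ∈ Icc 0 (dist x y), dist (γ u) y = dist x y - u := fun u hu => by
    have := hγ u hu _ h1m
    rwa [h1, abs_sub_comm, abs_of_nonneg (sub_nonneg.2 hu.2)] at this
  have hst := hγ s hs t ht
  have key : ∀ z : X, |dist o z - dist (γ s) z| ≤ R ∧ |dist (g⁻¹ • o) z - dist (γ t) z| ≤ R :=
    fun z => ⟨(abs_dist_sub_le o (γ s) z).trans (by rwa [dist_comm]),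
      (abs_dist_sub_le (g⁻¹ • o) (γ t) z).trans (by rwa [dist_comm])⟩
  have hd : dist o (g⁻¹ • o) ≤ R + |s - t| + R := by
    have := dist_triangle4 o (γ s) (γ t) (g⁻¹ • o)
    rw [dist_comm o (γ s), hst] at this
    linarith
  obtain ⟨kx1, kx2⟩ := key x
  obtain ⟨ky1, ky2⟩ := key y
  rw [dx s hs, abs_le] at kx1
  rw [dx t ht, abs_le] at kx2
  rw [dy s hs, abs_le] at ky1
  rw [dy t ht, abs_le] at ky2
  unfold IsCoarselyOrdered
  change (_ ≤ dist o y - dist (g⁻¹ • o) y ∧ dist o x - dist (g⁻¹ • o) x ≤ _) ∨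
    (_ ≤ dist o x - dist (g⁻¹ • o) x ∧ dist o y - dist (g⁻¹ • o) y ≤ _)
  rcases le_total s t with h | h
  · rw [abs_of_nonpos (by linarith)] at hd
    left
    constructor <;> linarith
  · rw [abs_of_nonneg (by linarith)] at hd
    right
    constructor <;> linarith

theorem isClosed_isCoarselyOrdered (C : ℝ) (x y : X) :
    IsClosed {p : Compactification X × Compactification X | IsCoarselyOrdered C p.1 p.2 x y} :=
  (isClosed_le continuous_const ((Compactification.continuous_eval x y).comp continuous_snd)).inter
    (isClosed_le ((Compactification.continuous_eval x y).comp continuous_fst) continuous_const)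

/-- If an open squeezing set contains `p` and `gp`, then `o` and `g⁻¹o` are close to the geodesics
joining the two coordinates of `p`. -/
theorem IsSqueezing.exists_isCoarselyOrdered (hX : IsGeodesicSpace X) (G : Type*) [Group G]
    [MulAction G X] [IsIsometricSMul G X] (o : X)
    {U : Set (Compactification X × Compactification X)} (hU : IsOpen U) (hs : IsSqueezing U) :
    ∃ C : ℝ, ∀ p ∈ U, ∀ g : G, g • p ∈ U →
      IsCoarselyOrdered C p.1 p.2 o (g⁻¹ • o) ∨ IsCoarselyOrdered C p.2 p.1 o (g⁻¹ • o) := by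
  obtain ⟨K, hK, hKU⟩ := hs
  obtain ⟨R, hR⟩ := hK.isBounded.subset_closedBall o
  refine ⟨4 * R, fun p hp g hgp => ?_⟩
  have hcl : IsClosed {p : Compactification X × Compactification X |
      IsCoarselyOrdered (4 * R) p.1 p.2 o (g⁻¹ • o) ∨
        IsCoarselyOrdered (4 * R) p.2 p.1 o (g⁻¹ • o)} :=
    (isClosed_isCoarselyOrdered _ _ _).union
      ((isClosed_isCoarselyOrdered _ _ _).preimage continuous_swap)
  -- The estimate is a closed condition on the pair, and pairs of points of `X` are dense in the
  -- open set of all `q ∈ U` with `gq ∈ U`.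
  have hopen : IsOpen (U ∩ (fun q => g • q) ⁻¹' U) :=
    hU.inter (hU.preimage (continuous_const_smul g))
  have hdense := (denseRange_toCompactification (X := X)).prodMap
    (denseRange_toCompactification (X := X))
  refine hcl.closure_subset_iff.2 ?_ (hdense.open_subset_closure_inter hopen ⟨hp, hgp⟩)
  rintro _ ⟨hq, ⟨x, y⟩, rfl⟩
  exact isCoarselyOrdered_of_squeezing hX hR hKU hq.1 hq.2

theorem smul_mem_radialLimitSet {o : X} (g : G) {c : Compactification X}
    (hc : c ∈ radialLimitSet G o) : g • c ∈ radialLimitSet G o := by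
  simp only [radialLimitSet, mem_iUnion] at hc ⊢
  obtain ⟨r, hr, h, b, hb, rfl⟩ := hc
  exact ⟨r, hr, g * h, b, hb, mul_smul g h b⟩

theorem smul_mem_radialLimitSet_iff {o : X} (g : G) {c : Compactification X} :
    g • c ∈ radialLimitSet G o ↔ c ∈ radialLimitSet G o :=
  ⟨fun h => by simpa using smul_mem_radialLimitSet g⁻¹ h, smul_mem_radialLimitSet g⟩

/-- Since `c(y, z) = c(o, z) - c(o, y) ≤ d(o, z) - d(o, y) + C`, the bracket in the Gromov product
of `o` and `c` at `y` is at most `C`. -/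
theorem mem_shadow_of_le_eval {o y : X} {C : ℝ} {c : Compactification X}
    (h : dist o y - C ≤ c o y) : c ∈ shadow o y (C / 2) := by
  refine iSup_le fun z => ENNReal.ofReal_le_ofReal ?_
  change (dist y o - dist z o + c y z) / 2 ≤ C / 2
  have h1 := c.cocycle o y z
  have h2 := c.le_dist o z
  rw [dist_comm] at h2
  rw [dist_comm] at h
  linarith

variable [ProperSpace X] [ProperlyDiscontinuousSMul G X]

theorem mem_radialLimitSet_of_infinite {o : X} {C : ℝ} {c : Compactification X}
    (hc : c ∈ horoboundary X)
    (h : {g : G | dist o (g • o) - C ≤ c o (g • o)}.Infinite) : c ∈ radialLimitSet G o := by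
  simp only [radialLimitSet, mem_iUnion]
  -- The maximum keeps the radius nonnegative when `C < 0`.
  refine ⟨max C 0 / 2, by positivity, 1, c, ⟨hc, fun T _ => ?_⟩, one_smul G c⟩
  obtain ⟨g, hg, hT⟩ := h.exists_notMem_finite (finite_dist_smul_le G o T)
  refine ⟨g, (not_le.1 hT).le, mem_shadow_of_le_eval ?_⟩
  have : dist o (g • o) - C ≤ c o (g • o) := hg
  linarith [le_max_left C 0]

/-- To show that an orbit visits a set finitely often, one may start at a point of the set. -/
theorem finite_smul_mem_of_mem {G Ω : Type*} [Group G] [MulAction G Ω] {W : Set Ω} {v : Ω}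
    (h : ∀ g : G, g • v ∈ W → {k : G | k • g • v ∈ W}.Finite) : {g : G | g • v ∈ W}.Finite := by
  rcases eq_empty_or_nonempty {g : G | g • v ∈ W} with he | ⟨g, hg⟩
  · rw [he]
    exact finite_empty
  · refine ((h g hg).image (· * g)).subset fun k hk => ⟨k * g⁻¹, ?_, by simp⟩
    simpa [smul_smul] using hk

theorem finite_inv_preimage {G : Type*} [Group G] {S : Set G} (h : S.Finite) :
    {g : G | g⁻¹ ∈ S}.Finite :=
  h.preimage inv_injective.injOn

/-- Each return `k` makes one of the two coordinates almost maximal on `(o, k⁻¹o)`; a non-radial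
coordinate allows this only finitely often. Invariance of the radial limit set permits starting at a
translate of `p` in `U`. -/
theorem IsSqueezing.finite_smul_mem (hX : IsGeodesicSpace X) (o : X)
    {U : Set (Compactification X × Compactification X)} (hU : IsOpen U) (hs : IsSqueezing U)
    {p : Compactification X × Compactification X}
    (h1 : p.1 ∈ horoboundary X \ radialLimitSet G o)
    (h2 : p.2 ∈ horoboundary X \ radialLimitSet G o) : {g : G | g • p ∈ U}.Finite := by
  obtain ⟨C, hC⟩ := hs.exists_isCoarselyOrdered hX G o hU
  refine finite_smul_mem_of_mem fun g hg => ?_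
  have hfin : ∀ c ∈ horoboundary X \ radialLimitSet G o,
      {k : G | dist o (k⁻¹ • o) - C ≤ (g • c) o (k⁻¹ • o)}.Finite := fun c hc =>
    finite_inv_preimage (S := {k : G | dist o (k • o) - C ≤ (g • c) o (k • o)})
      (not_infinite.1 fun h => hc.2 ((smul_mem_radialLimitSet_iff g).1
        (mem_radialLimitSet_of_infinite (smul_mem_horoboundary g hc.1) h)))
  refine ((hfin _ h2).union (hfin _ h1)).subset fun k hk => ?_
  rcases hC _ hg k hk with h | h
  · exact .inl h.1
  · exact .inr h.1

/-- No vector needs to be excluded here: the bound on the last coordinate gives `|τ| < 2T` between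
two visits, while coarse ordering gives `|τ| ≥ d(o, k⁻¹o) - C`, so properness of the action applies.
-/
theorem IsSqueezing.finite_smul_mem_SX (hX : IsGeodesicSpace X) (o : X)
    {U : Set (Compactification X × Compactification X)} (hU : IsOpen U) (hs : IsSqueezing U)
    (T : ℝ) (v : SX o) :
    {g : G | ((g • v).1 : Compactification X × Compactification X) ∈ U ∧ |(g • v).2| < T}.Finite := by
  obtain ⟨C, hC⟩ := hs.exists_isCoarselyOrdered hX G o hU
  refine finite_smul_mem_of_mem (W := {w : SX o |
    (w.1 : Compactification X × Compactification X) ∈ U ∧ |w.2| < T}) fun g hg => ?_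
  generalize g • v = w at hg ⊢
  refine (finite_inv_preimage (finite_dist_smul_le G o (C + 2 * T))).subset fun k hk => ?_
  change dist o (k⁻¹ • o) ≤ C + 2 * T
  have h1 := (abs_lt.1 hg.2)
  have h2 : |w.2 + translation o k w| < T := hk.2
  rw [abs_lt, translation] at h2
  have e1 := w.1.1.1.cocycle o (k⁻¹ • o) o
  have e2 := w.1.1.2.cocycle o (k⁻¹ • o) o
  have z1 := w.1.1.1.cocycle o o o
  have z2 := w.1.1.2.cocycle o o o
  rcases hC _ hg.1 k hk.1 with h | h <;> obtain ⟨h3, h4⟩ := h <;> linarith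

end Action

/-! ### Countable covers, measurable transversals and null sets. -/

section Measurability

variable {X : Type*} [MetricSpace X] [ProperSpace X]

instance : SecondCountableTopology (Compactification X) :=
  (Topology.IsEmbedding.subtypeVal.comp (Topology.IsEmbedding.subtypeVal
    (p := (· ∈ closure (range (pointCocycle (X := X))))))).secondCountableTopology

instance : T2Space (Compactification X) :=
  inferInstanceAs (T2Space (closure (range (pointCocycle (X := X)))))

instance (o : X) : MeasurableSpace.CountablySeparated (SX o) :=
  inferInstanceAs (MeasurableSpace.CountablySeparated (doubleBoundary o × ℝ))

theorem measurable_smul_SX {G : Type*} [Group G] [MulAction G X] [IsIsometricSMul G X] (o : X)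
    (g : G) : Measurable fun v : SX o => g • v := by
  have h1 : Measurable fun v : doubleBoundary o × ℝ =>
      (v.1 : Compactification X × Compactification X) := measurable_subtype_coe.comp measurable_fst
  have h2 : Measurable fun v : doubleBoundary o × ℝ =>
      g • (v.1 : Compactification X × Compactification X) :=
    (continuous_const_smul g).measurable.comp h1
  have ev : ∀ x y : X, Measurable fun c : Compactification X => c x y := fun x y =>
    (Compactification.continuous_eval x y).measurable
  have h3 : Measurable fun v : doubleBoundary o × ℝ =>
      v.2 + (v.1.1.2 (g⁻¹ • o) o - v.1.1.1 (g⁻¹ • o) o) / 2 :=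
    measurable_snd.add (((((ev _ _).comp measurable_snd).comp h1).sub
      (((ev _ _).comp measurable_fst).comp h1)).div_const 2)
  exact (h2.subtype_mk (h := fun v => smul_mem_doubleBoundary o g v.1.2)).prodMk h3

variable (X) in
/-- Countably many open squeezing sets cover `∂₀²X`. -/
theorem exists_seq_isSqueezing : ∃ U : ℕ → Set (Compactification X × Compactification X),
    (∀ n, IsOpen (U n) ∧ IsSqueezing (U n)) ∧ squeezingBoundary X ⊆ ⋃ n, U n := by
  obtain ⟨T, hTc, hTS, hT⟩ := TopologicalSpace.isOpen_sUnion_countable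
    {U : Set (Compactification X × Compactification X) | IsOpen U ∧ IsSqueezing U} fun U hU => hU.1
  -- The empty set is squeezing; adding it makes the countable family nonempty, so that `ℕ`
  -- enumerates it.
  obtain ⟨U, hU⟩ := (hTc.insert ∅).exists_eq_range (insert_nonempty _ _)
  refine ⟨U, fun n => ?_, ?_⟩
  · rcases hU ▸ mem_range_self n with h | h
    · rw [h]
      exact ⟨isOpen_empty, ∅, isCompact_empty, fun p hp => hp.elim⟩
    · exact hTS h
  · rintro p ⟨-, -, V, hV, K, hK, hKV⟩
    have hp : p ∈ ⋃₀ T := by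
      rw [hT]
      exact ⟨interior V, ⟨isOpen_interior, K, hK, fun q hq => hKV q (interior_subset hq)⟩,
        mem_interior_iff_mem_nhds.2 hV⟩
    rw [← sUnion_range, ← hU]
    exact sUnion_subset_sUnion (subset_insert _ _) hp

end Measurability

/-- A measurable action of a countable group whose orbits visit each set of a countable measurable
family finitely often has a measurable transversal on the union of the family. -/
theorem exists_measurable_transversal {Ω G : Type*} [MeasurableSpace Ω]
    [MeasurableSpace.CountablySeparated Ω] [Group G] [Countable G] [MulAction G Ω]
    (hG : ∀ g : G, Measurable fun v : Ω => g • v) (W : ℕ → Set Ω) (hW : ∀ n, MeasurableSet (W n))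
    (hfin : ∀ n v, {g : G | g • v ∈ W n}.Finite) :
    ∃ D : Set Ω, MeasurableSet D ∧ D ⊆ ⋃ n, W n ∧
      ∀ v ∈ ⋃ n, W n, ∃! w, w ∈ D ∧ w ∈ MulAction.orbit G v := by
  obtain ⟨f₀, hf₀, hf₀i⟩ := MeasurableSpace.measurable_injection_nat_bool_of_countablySeparated Ω
  obtain ⟨e, he⟩ := exists_measurableEmbedding_real (ℕ → Bool)
  set f : Ω → ℝ := e ∘ f₀ with hf_def
  have hf : Measurable f := he.measurable.comp hf₀
  have hfi : Function.Injective f := he.injective.comp hf₀i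
  -- In each orbit, take the first `W n` that it meets and, among its finitely many points there,
  -- the one minimizing the injective function `f`.
  set D : ℕ → Set Ω := fun n => {v | v ∈ W n ∧ (∀ m < n, ∀ g : G, g • v ∉ W m) ∧
    ∀ g : G, g • v ∈ W n → f v ≤ f (g • v)} with hD
  have hDm : ∀ n, MeasurableSet (D n) := fun n => by
    refine (hW n).inter (.inter ?_ ?_)
    · refine measurableSet_setOfPred.2 (.forall fun m => .forall fun _ => .forall fun g => ?_)
      exact measurableSet_setOfPred.1 (hG g (hW m)).compl
    · refine measurableSet_setOfPred.2 (.forall fun g => measurableSet_setOfPred.1 ?_)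
      have : {v : Ω | g • v ∈ W n → f v ≤ f (g • v)} =
          ((fun v => g • v) ⁻¹' W n)ᶜ ∪ {v | f v ≤ f (g • v)} := by
        ext v
        exact imp_iff_not_or
      exact this ▸ (hG g (hW n)).compl.union (measurableSet_le hf (hf.comp (hG g)))
  refine ⟨⋃ n, D n, .iUnion hDm, iUnion_mono fun n v hv => hv.1, fun v hv => ?_⟩
  classical
  have hex : ∃ n, ∃ g : G, g • v ∈ W n := by
    obtain ⟨n, hn⟩ := mem_iUnion.1 hv
    exact ⟨n, 1, by rwa [one_smul]⟩
  obtain ⟨g, hg, hmin⟩ := exists_min_image {g : G | g • v ∈ W (Nat.find hex)} (fun g => f (g • v))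
    (hfin _ v) (Nat.find_spec hex)
  refine ⟨g • v, ⟨mem_iUnion.2 ⟨Nat.find hex, hg, fun m hm k hk => ?_, fun k hk => ?_⟩,
    ⟨g, rfl⟩⟩, ?_⟩
  · exact Nat.find_min hex hm ⟨k * g, by rwa [mul_smul]⟩
  · rw [smul_smul]
    exact hmin _ (by rwa [smul_smul] at hk)
  · rintro _ ⟨hw, k, rfl⟩
    obtain ⟨n, hn, hlt, hle⟩ := mem_iUnion.1 hw
    dsimp only at hn hlt hle ⊢
    have hn_eq : n = Nat.find hex := by
      refine le_antisymm (not_lt.1 fun h => hlt _ h (g * k⁻¹) ?_) (Nat.find_min' hex ⟨k, hn⟩)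
      simpa [mul_smul] using hg
    subst hn_eq
    refine hfi (le_antisymm ?_ (hmin k hn))
    have := hle (g * k⁻¹)
    simp only [mul_smul, inv_smul_smul] at this
    exact this hg

/-- If the conditions defining `comap` fail, it is the zero measure by convention. So neither `∂²X`
nor `∂₀²X` has to be shown measurable, and the measurable hull does the same for the radial set. -/
theorem comap_preimage_eq_zero {α β : Type*} [MeasurableSpace α] [MeasurableSpace β] {f : α → β}
    (hf : Measurable f) {μ : Measure β} {N : Set β} (hN : μ N = 0) :
    μ.comap f (f ⁻¹' N) = 0 := by
  by_cases h : Function.Injective f ∧ ∀ s, MeasurableSet s → NullMeasurableSet (f '' s) μ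
  · refine measure_mono_null (preimage_mono (subset_toMeasurable μ N)) ?_
    rw [Measure.comap_apply₀ f μ h.1 h.2 (hf (measurableSet_toMeasurable μ N)).nullMeasurableSet]
    exact measure_mono_null (image_preimage_subset _ _) ((measure_toMeasurable N).trans hN)
  · rw [Measure.comap_undef h]
    rfl

/-! ### Null sets of radial vectors, saturations and sojourn times. -/

section Action

variable {X : Type*} [MetricSpace X] {G : Type*} [Group G] [MulAction G X] [IsIsometricSMul G X]

variable (G) in
theorem prod_radial_eq_zero {o : X} {μ : Measure (Compactification X)} [SFinite μ]
    (h : μ (radialLimitSet G o) = 0) :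
    μ.prod μ {p | p.1 ∈ radialLimitSet G o ∨ p.2 ∈ radialLimitSet G o} = 0 :=
  measure_union_null (Measure.quasiMeasurePreserving_fst.preimage_null h)
    (Measure.quasiMeasurePreserving_snd.preimage_null h)

variable (G) in
theorem bmMeasure_radial_eq_zero {o : X} (ω : ℝ) {ν : X → Measure (Compactification X)}
    [SFinite (ν o)] (h : ν o (radialLimitSet G o) = 0) :
    bmMeasure o ω ν {v | v.1.1.1 ∈ radialLimitSet G o ∨ v.1.1.2 ∈ radialLimitSet G o} = 0 := by
  have h1 := comap_preimage_eq_zero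
    (measurable_subtype_coe (p := (· ∈ doubleBoundary o))) (prod_radial_eq_zero G h)
  exact Measure.quasiMeasurePreserving_fst.preimage_null
    (withDensity_absolutelyContinuous _ _ h1)

theorem measurable_geodesicFlow (o : X) :
    Measurable fun q : SX o × ℝ => geodesicFlow o q.2 q.1 := by
  have : Measurable fun q : (doubleBoundary o × ℝ) × ℝ => (q.1.1, q.1.2 + q.2) := by fun_prop
  exact this

theorem geodesicFlow_smul (o : X) (t : ℝ) (g : G) (v : SX o) :
    geodesicFlow o t (g • v) = g • geodesicFlow o t v := by
  refine Prod.ext rfl ?_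
  change v.2 + translation o g v + t = v.2 + t + translation o g v
  ring

variable (G) in
/-- The union of all translates of `W`. -/
def saturation {o : X} (W : Set (SX o)) : Set (SX o) := ⋃ g : G, (fun v => g • v) ⁻¹' W

theorem smul_mem_saturation_iff {o : X} {W : Set (SX o)} (g : G) {v : SX o} :
    g • v ∈ saturation G W ↔ v ∈ saturation G W := by
  simp only [saturation, mem_iUnion, mem_preimage, smul_smul]
  exact ⟨fun ⟨k, hk⟩ => ⟨k * g, hk⟩, fun ⟨k, hk⟩ => ⟨k * g⁻¹, by simpa using hk⟩⟩

variable (G) in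
/-- The time which the orbit of `v` under the geodesic flow spends in the saturation of `W`. -/
noncomputable def sojournTime {o : X} (W : Set (SX o)) (v : SX o) : ℝ≥0∞ :=
  ∫⁻ t, (saturation G W).indicator 1 (geodesicFlow o t v)

theorem sojournTime_smul {o : X} {W : Set (SX o)} (g : G) (v : SX o) :
    sojournTime G W (g • v) = sojournTime G W v := by
  refine lintegral_congr fun t => ?_
  rw [geodesicFlow_smul]
  by_cases h : geodesicFlow o t v ∈ saturation G W
  · rw [indicator_of_mem h, indicator_of_mem ((smul_mem_saturation_iff g).2 h)]
    rfl
  · rw [indicator_of_notMem h, indicator_of_notMem (mt (smul_mem_saturation_iff g).1 h)]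

end Action

/-! ### Dissipativity of the group action and of the flow. -/

section ProperAction

variable {X : Type*} [MetricSpace X] [ProperSpace X] {G : Type*} [Group G] [MulAction G X]
  [IsIsometricSMul G X] [ProperlyDiscontinuousSMul G X]

theorem isDissipativeSMul_squeezingBoundary (hX : IsGeodesicSpace X) (o : X)
    {μ : Measure (Compactification X)} [SFinite μ] (h : μ (radialLimitSet G o) = 0) :
    IsDissipativeSMul G
      (Measure.comap (Subtype.val : squeezingBoundary X → _) (μ.prod μ)) := by
  obtain ⟨U, hU, hcov⟩ := exists_seq_isSqueezing X
  let : MeasurableSpace G := ⊤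
  refine ⟨fun n => Subtype.val ⁻¹' U n,
    fun n => ⟨measurable_subtype_coe (hU n).1.measurableSet, ?_⟩, ?_⟩
  · refine measure_mono_null (fun p hp => ?_)
      (comap_preimage_eq_zero measurable_subtype_coe (prod_radial_eq_zero G h))
    by_contra hrad
    refine hp fun _ => ?_
    have hrad' := not_or.1 hrad
    have hfin := (hU n).2.finite_smul_mem (G := G) hX o (hU n).1 ⟨p.2.1, hrad'.1⟩ ⟨p.2.2.1, hrad'.2⟩
    change ∫⁻ g : G, {g : G | g • (p : Compactification X × Compactification X) ∈ U n}.indicator 1 g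
      ∂Measure.count < ∞
    rw [lintegral_indicator_one MeasurableSpace.measurableSet_top]
    exact (Measure.count_apply_lt_top' MeasurableSpace.measurableSet_top).2 hfin
  · have : (⋃ n, Subtype.val ⁻¹' U n : Set (squeezingBoundary X)) = univ :=
      eq_univ_of_forall fun p => by simpa using hcov p.2
    rw [this, compl_univ, measure_empty]

/-- The vectors `(c, c', s)` with `(c, c') ∈ U` and `|s| < T`. -/
def flowBox (o : X) (U : Set (Compactification X × Compactification X)) (T : ℝ) : Set (SX o) :=
  {v | (v.1 : Compactification X × Compactification X) ∈ U ∧ |v.2| < T}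

theorem measurableSet_flowBox (o : X) {U : Set (Compactification X × Compactification X)}
    (hU : IsOpen U) (T : ℝ) : MeasurableSet (flowBox o U T) :=
  ((measurable_subtype_coe.comp measurable_fst : Measurable fun v : doubleBoundary o × ℝ =>
    (v.1 : Compactification X × Compactification X)) hU.measurableSet).inter
    (measurableSet_lt measurable_snd.abs measurable_const)

variable (X) in
/-- Countably many flow boxes over open squeezing sets cover `S₀X`. -/
theorem exists_seq_flowBox (o : X) :
    ∃ (U : ℕ → Set (Compactification X × Compactification X)) (T : ℕ → ℝ),
      (∀ n, IsOpen (U n) ∧ IsSqueezing (U n)) ∧ S₀X o = ⋃ n, flowBox o (U n) (T n) := by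
  obtain ⟨U, hU, hcov⟩ := exists_seq_isSqueezing X
  refine ⟨fun n => U n.unpair.1, fun n => (n.unpair.2 : ℝ), fun n => hU _, Subset.antisymm ?_ ?_⟩
  · intro v hv
    obtain ⟨i, hi⟩ := mem_iUnion.1 (hcov hv)
    obtain ⟨j, hj⟩ := exists_nat_gt |v.2|
    exact mem_iUnion.2 ⟨Nat.pair i j, by simpa [flowBox] using ⟨hi, hj⟩⟩
  -- An open squeezing set is itself a squeezing neighbourhood of each of its points.
  · refine iUnion_subset fun n v hv => ⟨v.1.2.1, v.1.2.2.1, _, (hU _).1.mem_nhds hv.1, (hU _).2⟩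

variable (G) in
theorem exists_isMeasurableDomain (hX : IsGeodesicSpace X) (o : X) :
    ∃ D : Set (SX o), IsMeasurableDomain G o D := by
  obtain ⟨U, T, hU, hcov⟩ := exists_seq_flowBox X o
  have : Countable G := countable_of_properlyDiscontinuous G o
  obtain ⟨D, hD, hsub, hD'⟩ := exists_measurable_transversal (G := G) (measurable_smul_SX o)
    (fun n => flowBox o (U n) (T n)) (fun n => measurableSet_flowBox o (hU n).1 _)
    fun n v => (hU n).2.finite_smul_mem_SX hX o (hU n).1 (T n) v
  rw [← hcov] at hsub hD'
  exact ⟨D, hD, hsub, hD'⟩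

theorem measurableSet_saturation {o : X} {W : Set (SX o)} (hW : MeasurableSet W) :
    MeasurableSet[invariantSigma G o] (saturation G W) := by
  have : Countable G := countable_of_properlyDiscontinuous G o
  exact ⟨.iUnion fun g => measurable_smul_SX o g hW, fun g => ext fun v => smul_mem_saturation_iff g⟩

theorem measurable_sojournTime {o : X} {W : Set (SX o)} (hW : MeasurableSet W) :
    Measurable (sojournTime G W) := by
  have h : Measurable fun q : SX o × ℝ =>
      (saturation G W).indicator (1 : SX o → ℝ≥0∞) (geodesicFlow o q.2 q.1) :=
    (measurable_one.indicator (measurableSet_saturation (G := G) hW).1).comp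
      (measurable_geodesicFlow o)
  exact h.lintegral_prod_right'

/-- The flow does not change `(c, c')`, so only the finitely many `g` with `g(c, c') ∈ U` matter,
and each contributes an interval of length at most `2T`. -/
theorem sojournTime_lt_top (hX : IsGeodesicSpace X) {o : X}
    {U : Set (Compactification X × Compactification X)} (hU : IsOpen U) (hs : IsSqueezing U)
    (T : ℝ) {v : SX o} (h1 : v.1.1.1 ∉ radialLimitSet G o) (h2 : v.1.1.2 ∉ radialLimitSet G o) :
    sojournTime G (flowBox o U T) v < ∞ := by
  have hfin := hs.finite_smul_mem (G := G) hX o hU ⟨v.1.2.1, h1⟩ ⟨v.1.2.2.1, h2⟩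
  set S : Set ℝ := ⋃ g ∈ {g : G | g • (v.1 : Compactification X × Compactification X) ∈ U},
    Metric.ball (-(v.2 + translation o g v)) T with hS
  have hSvol : volume S < ∞ :=
    measure_biUnion_lt_top hfin fun g _ => measure_ball_lt_top
  refine lt_of_le_of_lt ?_ hSvol
  refine le_trans (lintegral_mono (g := S.indicator 1) fun t => ?_) (lintegral_indicator_one_le S)
  by_cases h : geodesicFlow o t v ∈ saturation G (flowBox o U T)
  · obtain ⟨g, hg, ht⟩ := mem_iUnion.1 h
    have htS : t ∈ S := by
      refine mem_biUnion (show g ∈ {g : G | _} from hg) ?_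
      rw [Metric.mem_ball, Real.dist_eq]
      have ht' : |v.2 + t + translation o g v| < T := ht
      convert ht' using 2
      ring
    rw [indicator_of_mem h, indicator_of_mem htS]
    rfl
  · rw [indicator_of_notMem h]
    exact zero_le

theorem isDissipativeFlow_bmQuotientMeasure (hX : IsGeodesicSpace X) {o : X} (ω : ℝ)
    {ν : X → Measure (Compactification X)} [SFinite (ν o)]
    (h : ν o (radialLimitSet G o) = 0) {D : Set (SX o)} (hD : IsMeasurableDomain G o D) :
    IsDissipativeFlow (invariantSigma G o) (geodesicFlow o) (bmQuotientMeasure G o ω ν D) := by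
  obtain ⟨U, T, hU, hcov⟩ := exists_seq_flowBox X o
  have hW : ∀ n, MeasurableSet (flowBox o (U n) (T n)) := fun n => measurableSet_flowBox o (hU n).1 _
  have hWG : ∀ n, MeasurableSet[invariantSigma G o] (saturation G (flowBox o (U n) (T n))) :=
    fun n => measurableSet_saturation (hW n)
  refine ⟨fun n => saturation G (flowBox o (U n) (T n)), fun n => ⟨hWG n, ?_⟩, ?_⟩
  -- A trimmed measure is computed only on invariant sets, so the exceptional vectors are enclosed
  -- in the invariant measurable set of infinite sojourn time, which contains radial vectors only.
  · have hB : MeasurableSet[invariantSigma G o]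
        {v : SX o | sojournTime G (flowBox o (U n) (T n)) v = ∞} :=
      ⟨measurable_sojournTime (hW n) (measurableSet_singleton ∞),
        fun g => ext fun v => by simp [sojournTime_smul]⟩
    have hB0 : bmQuotientMeasure G o ω ν D
        {v : SX o | sojournTime G (flowBox o (U n) (T n)) v = ∞} = 0 := by
      rw [bmQuotientMeasure, trim_measurableSet_eq _ hB]
      refine withDensity_absolutelyContinuous _ _
        (measure_mono_null (fun v hv => ?_) (bmMeasure_radial_eq_zero G ω h))
      by_contra hrad
      have hrad' := not_or.1 hrad
      exact (sojournTime_lt_top hX (hU n).1 (hU n).2 (T n) hrad'.1 hrad'.2).ne hv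
    refine measure_mono_null (fun v hv => ?_) hB0
    by_contra hne
    exact hv fun _ => lt_top_iff_ne_top.2 hne
  · have hC := (MeasurableSet.iUnion hWG).compl
    rw [bmQuotientMeasure, trim_measurableSet_eq _ hC, withDensity_apply _ hC.1]
    -- The density `ξ 1_D` vanishes off `D`, and `D ⊆ S₀X` is covered by the boxes, hence by their
    -- saturations.
    refine (setLIntegral_congr_fun hC.1 fun v hv => ?_).trans (lintegral_zero)
    refine indicator_of_notMem (fun hvD => hv ?_) _
    obtain ⟨n, hn⟩ := mem_iUnion.1 (hcov ▸ hD.2.1 hvD)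
    exact mem_iUnion.2 ⟨n, mem_iUnion.2 ⟨1, by simpa using hn⟩⟩

end ProperAction

end Horo

theorem mainTheorem6 {X : Type*} [MetricSpace X] [ProperSpace X] (hX : Horo.IsGeodesicSpace X)
    {G : Type*} [Group G] [MulAction G X] [IsIsometricSMul G X] [ProperlyDiscontinuousSMul G X]
    (hcontr : ∃ g : G, Horo.IsContractingElement (X := X) g)
    (hvc : ¬ Horo.IsVirtuallyCyclic G)
    (o : X) (ω : ℝ) (hω : 0 ≤ ω) (ν : X → Measure (Horo.Compactification X))
    (hν : Horo.IsDensity o ν) (hinv : Horo.IsInvariantDensity G ν)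
    (hconf : Horo.IsConformalDensity ω ν)
    (hsupp : ∀ x : X, ν x (Horo.horoboundary X)ᶜ = 0)
    (hrad : ν o (Horo.radialLimitSet G o) = 0) :
    Horo.IsDissipativeSMul G
        (Measure.comap (Subtype.val : Horo.squeezingBoundary X → _) ((ν o).prod (ν o))) ∧
      (∃ D : Set (Horo.SX o), Horo.IsMeasurableDomain G o D) ∧
      ∀ D : Set (Horo.SX o), Horo.IsMeasurableDomain G o D →
        Horo.IsDissipativeFlow (Horo.invariantSigma G o) (Horo.geodesicFlow o)
          (Horo.bmQuotientMeasure G o ω ν D) := by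
  have := hν.finite o
  exact ⟨Horo.isDissipativeSMul_squeezingBoundary hX o hrad, Horo.exists_isMeasurableDomain G hX o,
    fun D hD => Horo.isDissipativeFlow_bmQuotientMeasure hX ω hrad hD⟩
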